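/- **Theorem 4.** Let $X\in\mathbb{R}^{n\times p}$ be a matrix with unit $\ell_2$-norm columns $X_1,\dots,X_p$, and let $$\mu=\max_{i\ne j}|X_i^\top X_j|,\qquad \nu=\frac{1}{p-1}\max_i\Big|\sum_{j\ne i}X_i^\top X_j\Big|$$ be its worst-case and average coherences. Suppose that $X$ has the coherence property with a constant $c_\mu>10\sqrt2$, i.e. $\mu<\frac{1}{c_\mu\sqrt{\log p}}$ and $\nu<\frac{\mu}{\sqrt n}$. Let $y=X\beta+\eta$, where the entries of $\eta\in\mathbb{R}^n$ are independent $\mathcal{N}(0,\sigma^2)$ random variables and $\beta\in\mathbb{R}^p$ is $k$-sparse (it has exactly $k\ge 1$ nonzero entries) with a uniformly random support: there are fixed nonzero real numbers $z_1,\dots,z_k$ and a uniformly random ordered $k$-tuple $(\pi_1,\dots,\pi_k)$ of distinct elements of $\{1,\dots,p\}$ such that $\beta_{\pi_j}=z_j$ for $j=1,\dots,k$ and all other entries of $\beta$ vanish. Thus the support $\mathcal{S}=\{i:\beta_i\neq0\}=\{\pi_1,\dots,\pi_k\}$ is drawn uniformly at random from the $k$-subsets of $\{1,\dots,p\}$,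 while $\beta_{\min}:=\min_{i\in\mathcal{S}}|\beta_i|=\min_j|z_j|$ and $\|\beta\|_2=\|z\|_2$ are deterministic. Suppose $p\ge\max\{2n,e^5\}$, $$k<\frac{\mu^{-2}}{c_\mu^2\log p}\qquad\text{and}\qquad \frac{\beta_{\min}}{\|\beta\|_2}>2c_\mu\mu\sqrt{\log p}+\frac{4\sqrt{\sigma^2\log p}}{\|\beta\|_2}.$$ For an integer $d\le p$, let marginal correlation-based screening be the algorithm that computes $w=X^\top y$ and outputs a set $\widehat{\mathcal{S}}\subset\{1,\dots,p\}$ with $|\widehat{\mathcal{S}}|=d$ consisting of indices of $d$ largest values among $|w_1|,\dots,|w_p|$ (ties broken arbitrarily). If $$d\ge\left\lceil\frac{\sqrt k}{\frac{\beta_{\min}}{\|\beta\|_2}-2c_\mu\mu\sqrt{\log p}-\frac{4\sqrt{\sigma^2\log p}}{\|\beta\|_2}}\right\rceil,$$ then, with probability exceeding $1-6p^{-1}$ (over $\pi$ and $\eta$), $\mathcal{S}\subset\widehat{\mathcal{S}}$. -/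

import Mathlib

open MeasureTheory ProbabilityTheory
open scoped NNReal Matrix

namespace ExSIS

/-- All columns of the design matrix have unit Euclidean norm. -/
def UnitColumns {n p : ℕ} (X : Matrix (Fin n) (Fin p) ℝ) : Prop :=
  ∀ i, ‖WithLp.toLp 2 (X.col i)‖ = 1

/-- Worst-case coherence: the maximum over `i ≠ j` of `|X_iᵀ X_j|`. -/
noncomputable def worstCoherence {n p : ℕ} (X : Matrix (Fin n) (Fin p) ℝ) : ℝ :=
  ⨆ q : {q : Fin p × Fin p // q.1 ≠ q.2}, |X.col q.1.1 ⬝ᵥ X.col q.1.2|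

/-- Average coherence: `(p - 1)⁻¹` times the maximum over `i` of `|∑_{j ≠ i} X_iᵀ X_j|`. -/
noncomputable def averageCoherence {n p : ℕ} (X : Matrix (Fin n) (Fin p) ℝ) : ℝ :=
  1 / ((p : ℝ) - 1) * ⨆ i : Fin p, |∑ j ∈ Finset.univ.erase i, X.col i ⬝ᵥ X.col j|

/-- The coherence property with constant `c`, for a matrix with unit-norm columns. -/
def CoherenceProperty {n p : ℕ} (X : Matrix (Fin n) (Fin p) ℝ) (c : ℝ) : Prop :=
  UnitColumns X ∧ 0 < c ∧
    worstCoherence X < 1 / (c * √(Real.log p)) ∧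
    averageCoherence X < worstCoherence X / √(n : ℝ)

/-- The support of a vector. -/
noncomputable def supp {p : ℕ} (β : EuclideanSpace ℝ (Fin p)) : Finset (Fin p) :=
  Finset.univ.filter fun i => β i ≠ 0

/-- The parameter vector with the value `z j` at position `f j` and zeros elsewhere. -/
noncomputable def signal {k p : ℕ} (z : EuclideanSpace ℝ (Fin k)) (f : Fin k ↪ Fin p) :
    EuclideanSpace ℝ (Fin p) :=
  ∑ j, z j • EuclideanSpace.single (f j) (1 : ℝ)

/-- `S` is a possible output of marginal correlation-based screening with input `X`, `y`, `d`:
a set of `d` indices whose marginal correlations `|w_i|`, `w = Xᵀ y`, are `d` largest ones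
(ties may be broken in any way). -/
def IsScreeningOutput {n p : ℕ} (X : Matrix (Fin n) (Fin p) ℝ) (y : Fin n → ℝ) (d : ℕ)
    (S : Finset (Fin p)) : Prop :=
  S.card = d ∧ ∀ i ∈ S, ∀ j ∉ S, |(Xᵀ *ᵥ y) j| ≤ |(Xᵀ *ᵥ y) i|

/-- The random element `Y` is uniformly distributed on the finite type `α`. -/
def IsUniform {Ω α : Type*} [MeasurableSpace Ω] (P : Measure Ω) (Y : Ω → α) : Prop :=
  ∀ a, MeasurableSet {ω | Y ω = a} ∧ P.real {ω | Y ω = a} = 1 / (Nat.card α : ℝ)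

end ExSIS

/-! Since the columns are normalised, `w i = β i + (interference) + (noise)`, where the interference
is a weighted sum of off-diagonal Gram entries over the random support. If all interferences are at
most `τ = c μ √log p ‖z‖` and all noises at most `ε = 2 √(σ² log p)`, then `βmin > 2 (τ + ε)` puts
every active `|w i|` above every inactive one, and any output of size `d ≥ k` contains the support.

The main point is the interference tail. The sum is sampled without replacement, and
`sum_embedding_exp_le` bounds its moment generating function by induction on the number of draws.
This needs `20 k ≤ p`, which follows from the sparsity hypothesis and the Welch bound; the average
coherence controls the mean. Each column fails with probability at most `2 / p²` for interference
and `2 / p²` for noise, so a union bound over `p` columns costs `4 / p < 6 / p`. -/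

namespace ExSIS

/-! ### Concentration for sampling without replacement. -/

/-- Finite form of Hoeffding's lemma, with the oscillation `R` of `b` in place of its range. -/
theorem sum_exp_mul_le {ι : Type*} [Fintype ι] [Nonempty ι] (b : ι → ℝ) {R : ℝ}
    (hR : ∀ i j, |b i - b j| ≤ R) (t : ℝ) :
    ∑ i, Real.exp (t * b i) ≤ (Fintype.card ι : ℝ) *
      Real.exp (t * ((∑ i, b i) / Fintype.card ι) + t ^ 2 * R ^ 2 / 2) := by
  set N : ℝ := (Fintype.card ι : ℝ) with hN
  have hNpos : 0 < N := by rw [hN]; exact_mod_cast Fintype.card_pos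
  set m : ℝ := (∑ i, b i) / N with hm
  -- Jensen's inequality, from the tangent line of the exponential at the mean.
  have hlow : N * Real.exp (-(t * m)) ≤ ∑ i, Real.exp (-(t * b i)) := by
    have h1 : ∀ i, Real.exp (-(t * m)) * (1 - t * (b i - m)) ≤ Real.exp (-(t * b i)) := by
      intro i
      have : Real.exp (-(t * b i)) = Real.exp (-(t * m)) * Real.exp (-(t * (b i - m))) := by
        rw [← Real.exp_add]; ring_nf
      rw [this]
      gcongr
      linarith [Real.add_one_le_exp (-(t * (b i - m)))]
    have h2 : ∑ i, Real.exp (-(t * m)) * (1 - t * (b i - m)) = N * Real.exp (-(t * m)) := by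
      rw [← Finset.mul_sum, Finset.sum_sub_distrib, ← Finset.mul_sum, Finset.sum_sub_distrib]
      have : ∑ i, b i = N * m := by rw [hm]; field_simp
      simp only [Finset.sum_const, Finset.card_univ, nsmul_eq_mul, ← hN, this]
      ring
    rw [← h2]
    exact Finset.sum_le_sum fun i _ => h1 i
  -- Symmetrisation: the product is a double sum over differences, where swapping indices turns
  -- `exp` into `cosh`. Dividing by `hlow` then gives the claim.
  have hprod : (∑ i, Real.exp (t * b i)) * ∑ i, Real.exp (-(t * b i)) ≤
      N ^ 2 * Real.exp (t ^ 2 * R ^ 2 / 2) := by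
    have e1 : (∑ i, Real.exp (t * b i)) * ∑ i, Real.exp (-(t * b i)) =
        ∑ i, ∑ j, Real.exp (t * (b i - b j)) := by
      rw [Finset.sum_mul_sum]
      refine Finset.sum_congr rfl fun i _ => Finset.sum_congr rfl fun j _ => ?_
      rw [← Real.exp_add]; ring_nf
    have e2 : ∑ i, ∑ j, Real.exp (t * (b i - b j)) = ∑ i, ∑ j, Real.cosh (t * (b i - b j)) := by
      have e3 : ∑ i, ∑ j, Real.exp (t * (b i - b j)) = ∑ i, ∑ j, Real.exp (-(t * (b i - b j))) := by
        rw [Finset.sum_comm]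
        refine Finset.sum_congr rfl fun i _ => Finset.sum_congr rfl fun j _ => ?_
        ring_nf
      simp only [Real.cosh_eq, ← Finset.sum_div, Finset.sum_add_distrib, ← e3]
      ring
    rw [e1, e2]
    calc ∑ i, ∑ j, Real.cosh (t * (b i - b j))
        ≤ ∑ _i : ι, ∑ _j : ι, Real.exp (t ^ 2 * R ^ 2 / 2) := by
          refine Finset.sum_le_sum fun i _ => Finset.sum_le_sum fun j _ => ?_
          refine (Real.cosh_le_exp_half_sq _).trans (Real.exp_le_exp.2 ?_)
          have := sq_le_sq' (by linarith [abs_nonneg (b i - b j), hR i j]) (hR i j)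
          rw [sq_abs] at this
          rw [mul_pow]
          gcongr
      _ = _ := by simp [hN]; ring
  have hS : 0 ≤ ∑ i, Real.exp (t * b i) := Finset.sum_nonneg fun i _ => (Real.exp_pos _).le
  have h := (mul_le_mul_of_nonneg_left hlow hS).trans hprod
  have hexp : Real.exp (t * m + t ^ 2 * R ^ 2 / 2) * Real.exp (-(t * m)) =
      Real.exp (t ^ 2 * R ^ 2 / 2) := by
    rw [← Real.exp_add]; ring_nf
  have hpos : 0 < N * Real.exp (-(t * m)) := by positivity
  refine le_of_mul_le_mul_right (h.trans_eq ?_) hpos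
  rw [← hexp]; ring

/-- The variance proxy of a weighted sum sampled without replacement grows slowly with the
number of draws. -/
theorem proxy_step {N p k V s t : ℝ} (hp : 0 < p) (hk : 0 ≤ k) (hkp : 20 * (k + 1) ≤ p)
    (hN : N = p - k) (hV : 0 ≤ V) (hst : s ^ 2 ≤ k * V) :
    t ^ 2 + (2 + 40 * k / p) * (V - 2 * (t / N) * s + k * (t / N) ^ 2) ≤
      (2 + 40 * (k + 1) / p) * (t ^ 2 + V) := by
  have hNp : 0.95 * p ≤ N := by linarith
  have hNpos : 0 < N := by linarith
  have hkN : 19 * k ≤ N := by linarith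
  have hC : 40 * k / p ≤ 2 := by rw [div_le_iff₀ hp]; linarith
  have hC0 : 0 ≤ 40 * k / p := by positivity
  have hN1 : 1 ≤ N := by linarith
  have hcross : -(2 * t * s) ≤ k * t ^ 2 + V := by
    rcases hk.eq_or_lt with rfl | hk'
    · have : s = 0 := by nlinarith [sq_nonneg s]
      simp [this, hV]
    · have h1 : s ^ 2 / k ≤ V := by rw [div_le_iff₀ hk']; linarith
      have h2 : 0 ≤ k * (t + s / k) ^ 2 := by positivity
      have h3 : k * (t + s / k) ^ 2 = k * t ^ 2 + 2 * t * s + s ^ 2 / k := by field_simp; ring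
      linarith
  have hd : -(2 * (t / N) * s) ≤ (k * t ^ 2 + V) / N := by
    rw [show -(2 * (t / N) * s) = (-(2 * t * s)) / N by ring]
    gcongr
  have hq : k * (t / N) ^ 2 ≤ k * t ^ 2 / N := by
    rw [div_pow, ← mul_div_assoc]
    gcongr
    nlinarith
  have hkt : k * t ^ 2 / N ≤ t ^ 2 / 19 := by
    rw [div_le_div_iff₀ hNpos (by norm_num)]
    nlinarith [sq_nonneg t]
  have hVN : V / N ≤ V * (10 / (9 * p)) := by
    rw [div_eq_mul_one_div]
    refine mul_le_mul_of_nonneg_left ?_ hV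
    rw [div_le_div_iff₀ hNpos (by positivity)]
    nlinarith
  have hb : V - 2 * (t / N) * s + k * (t / N) ^ 2 ≤ V + V * (10 / (9 * p)) + 2 * (t ^ 2 / 19) := by
    rw [add_div] at hd
    linarith
  have h4 : (2 + 40 * k / p) * (V - 2 * (t / N) * s + k * (t / N) ^ 2) ≤
      (2 + 40 * k / p) * V + 4 * (V * (10 / (9 * p)) + 2 * (t ^ 2 / 19)) := by
    calc _ ≤ (2 + 40 * k / p) * (V + V * (10 / (9 * p)) + 2 * (t ^ 2 / 19)) := by gcongr
      _ = (2 + 40 * k / p) * V + (2 + 40 * k / p) * (V * (10 / (9 * p)) + 2 * (t ^ 2 / 19)) := by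
        ring
      _ ≤ _ := by gcongr; linarith
  have h5 : (2 + 40 * (k + 1) / p) * (t ^ 2 + V) =
      (2 + 40 * k / p) * V + 40 / p * V + (2 + 40 * (k + 1) / p) * t ^ 2 := by ring
  have h6 : 4 * (V * (10 / (9 * p))) ≤ 40 / p * V := by
    have : 4 * (V * (10 / (9 * p))) = (40 / p * V) / 9 := by field_simp; ring
    have : 0 ≤ 40 / p * V := by positivity
    linarith
  have h7 : 0 ≤ 40 * (k + 1) / p * t ^ 2 := by positivity
  -- The coefficient of `t ^ 2` on the left is `1 + 8 / 19 < 2`: starting the proxy at 2 absorbs the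
  -- cross terms, and its growth `40 / p` absorbs the `V / N` error.
  nlinarith [sq_nonneg t]

/-- Moment generating function of a weighted sum `∑ j, z j * a (f j)` for a uniformly random
injection `f`, when `a` sums to zero and the number of draws is a small fraction of the
population. -/
theorem sum_embedding_exp_le {ι : Type*} [Fintype ι] [DecidableEq ι] (a : ι → ℝ)
    (ha : ∑ i, a i = 0) {R : ℝ} (hR : ∀ i j, |a i - a j| ≤ R) (k : ℕ)
    (hk : 20 * k ≤ Fintype.card ι) (z : Fin k → ℝ) :
    ∑ f : Fin k ↪ ι, Real.exp (∑ j, z j * a (f j)) ≤ Fintype.card (Fin k ↪ ι) *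
      Real.exp ((2 + 40 * k / Fintype.card ι) * (R ^ 2 / 2) * ∑ j, z j ^ 2) := by
  induction k with
  | zero => simp
  | succ k ih =>
    set p : ℕ := Fintype.card ι with hp
    have hkp : k < p := by omega
    have hp0 : (0 : ℝ) < p := by exact_mod_cast (by omega : 0 < p)
    set N : ℝ := (p : ℝ) - k with hN
    have hcard (e : Fin k ↪ ι) : Fintype.card {i // i ∉ Set.range e} = p - k := by
      have h : Fintype.card {i // i ∈ Set.range e} = k := by
        rw [← Fintype.card_congr (Equiv.ofInjective e e.injective), Fintype.card_fin]
      rw [Fintype.card_subtype_compl, h]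
    have hNcast : ((p - k : ℕ) : ℝ) = N := by rw [Nat.cast_sub hkp.le]
    have hNpos : 0 < N := by rw [← hNcast]; exact_mod_cast (by omega : 0 < p - k)
    have hmean (e : Fin k ↪ ι) : ∑ i : {i // i ∉ Set.range e}, a i = -∑ j, a (e j) := by
      have h1 := Fintype.sum_subtype_add_sum_subtype (fun i => i ∈ Set.range e) a
      have h2 (_ : Fintype {i // i ∈ Set.range e}) :
          ∑ i : {i // i ∈ Set.range e}, a i = ∑ j, a (e j) :=
        ((Equiv.ofInjective e e.injective).sum_comp fun i => a i.1).symm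
      rw [h2, ha] at h1
      convert! eq_neg_of_add_eq_zero_right h1
    -- Given the other `k` draws, the draw with weight `z 0` is uniform on the `N` remaining points,
    -- whose mean is `-(∑ a (e j)) / N` because `a` sums to zero. Averaging it out shifts every
    -- other weight by `z 0 / N`; hence the induction must allow arbitrary weights.
    set u : Fin k → ℝ := fun j => z j.succ - z 0 / N with hu
    have hinner (e : Fin k ↪ ι) : ∑ i : {i // i ∉ Set.range e},
        Real.exp (z 0 * a i + ∑ j, z (Fin.succ j) * a (e j)) ≤
        N * Real.exp (z 0 ^ 2 * R ^ 2 / 2) * Real.exp (∑ j, u j * a (e j)) := by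
      have : Nonempty {i // i ∉ Set.range e} := by
        rw [← Fintype.card_pos_iff, hcard]; omega
      have h := sum_exp_mul_le (fun i : {i // i ∉ Set.range e} => a i)
        (fun i j => hR i j) (z 0)
      rw [hcard, hmean, hNcast] at h
      calc _ = (∑ i : {i // i ∉ Set.range e}, Real.exp (z 0 * a i)) *
            Real.exp (∑ j, z (Fin.succ j) * a (e j)) := by
            rw [Finset.sum_mul]
            exact Finset.sum_congr rfl fun i _ => Real.exp_add _ _
        _ ≤ (N * Real.exp (z 0 * ((-∑ j, a (e j)) / N) + z 0 ^ 2 * R ^ 2 / 2)) *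
            Real.exp (∑ j, z (Fin.succ j) * a (e j)) := by gcongr
        _ = _ := by
            rw [mul_assoc, mul_assoc, ← Real.exp_add, ← Real.exp_add]
            congr 2
            have : ∑ j, u j * a (e j) =
                ∑ j, z (Fin.succ j) * a (e j) - z 0 / N * ∑ j, a (e j) := by
              simp only [hu, sub_mul, Finset.sum_sub_distrib, Finset.mul_sum]
            rw [this]; ring
    have hsplit : ∑ f : Fin (k + 1) ↪ ι, Real.exp (∑ j, z j * a (f j)) =
        ∑ e : Fin k ↪ ι, ∑ i : {i // i ∉ Set.range e},
          Real.exp (z 0 * a i + ∑ j, z (Fin.succ j) * a (e j)) := by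
      rw [← Fintype.sum_sigma', ← (Equiv.embeddingFinSucc k ι).symm.sum_comp]
      refine Finset.sum_congr rfl fun x _ => ?_
      rw [Fin.sum_univ_succ]
      simp
    have hcs : (Fintype.card (Fin (k + 1) ↪ ι) : ℝ) = N * Fintype.card (Fin k ↪ ι) := by
      rw [Fintype.card_embedding_eq, Fintype.card_embedding_eq, Fintype.card_fin,
        Fintype.card_fin, Nat.descFactorial_succ, Nat.cast_mul, ← hp, hNcast]
    have husq : ∑ j, u j ^ 2 = ∑ j : Fin k, z j.succ ^ 2 - 2 * (z 0 / N) * ∑ j : Fin k, z j.succ +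
        k * (z 0 / N) ^ 2 := by
      simp only [hu, sub_sq, Finset.sum_add_distrib, Finset.sum_sub_distrib, Finset.mul_sum,
        Finset.sum_const, Finset.card_univ, Fintype.card_fin, nsmul_eq_mul]
      congr 2
      exact Finset.sum_congr rfl fun j _ => by ring
    have hstep := proxy_step (N := N) (p := p) (k := k) (V := ∑ j : Fin k, z j.succ ^ 2)
      (s := ∑ j : Fin k, z j.succ) (t := z 0) hp0 (by positivity) (by exact_mod_cast hk) hN
      (by positivity) (by
        simpa using sq_sum_le_card_mul_sum_sq (s := Finset.univ) (f := fun j : Fin k => z j.succ))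
    rw [← husq] at hstep
    rw [hsplit]
    calc _ ≤ ∑ e : Fin k ↪ ι, N * Real.exp (z 0 ^ 2 * R ^ 2 / 2) *
            Real.exp (∑ j, u j * a (e j)) := Finset.sum_le_sum fun e _ => hinner e
      _ = N * Real.exp (z 0 ^ 2 * R ^ 2 / 2) *
            ∑ e : Fin k ↪ ι, Real.exp (∑ j, u j * a (e j)) := by rw [Finset.mul_sum]
      _ ≤ N * Real.exp (z 0 ^ 2 * R ^ 2 / 2) * (Fintype.card (Fin k ↪ ι) *
            Real.exp ((2 + 40 * k / p) * (R ^ 2 / 2) * ∑ j, u j ^ 2)) := by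
            gcongr
            exact ih (by omega) u
      _ = (N * Fintype.card (Fin k ↪ ι)) * Real.exp ((R ^ 2 / 2) *
            (z 0 ^ 2 + (2 + 40 * k / p) * ∑ j, u j ^ 2)) := by
            rw [show (R ^ 2 / 2) * (z 0 ^ 2 + (2 + 40 * k / p) * ∑ j, u j ^ 2) =
              z 0 ^ 2 * R ^ 2 / 2 + (2 + 40 * k / p) * (R ^ 2 / 2) * ∑ j, u j ^ 2 by ring,
              Real.exp_add]
            ring
      _ ≤ _ := by
            rw [hcs, Fin.sum_univ_succ]
            refine mul_le_mul_of_nonneg_left (Real.exp_le_exp.2 ?_) (by positivity)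
            push_cast
            calc _ ≤ R ^ 2 / 2 * ((2 + 40 * (k + 1) / p) *
                  (z 0 ^ 2 + ∑ j : Fin k, z j.succ ^ 2)) :=
                  mul_le_mul_of_nonneg_left hstep (by positivity)
              _ = _ := by ring

/-- One-sided tail of a weighted sum over a uniformly random injection. -/
theorem card_embedding_lt_sum_le {ι : Type*} [Fintype ι] [DecidableEq ι] (a : ι → ℝ)
    (ha : ∑ i, a i = 0) {R : ℝ} (hR : ∀ i j, |a i - a j| ≤ R) (hR0 : 0 < R) {k : ℕ}
    (hk : 20 * k ≤ Fintype.card ι) (z : Fin k → ℝ) (hz : 0 < ∑ j, z j ^ 2) {t : ℝ} (ht : 0 ≤ t) :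
    ((Finset.univ.filter fun f : Fin k ↪ ι => t < ∑ j, z j * a (f j)).card : ℝ) ≤
      Fintype.card (Fin k ↪ ι) * Real.exp (-(t ^ 2 / (8 * R ^ 2 * ∑ j, z j ^ 2))) := by
  set V := ∑ j, z j ^ 2 with hV
  -- Minimiser of the Chernoff exponent `2 R² V l² - l t`; the proxy coefficient is at most 4 since
  -- `20 k ≤ card ι`.
  set l : ℝ := t / (4 * R ^ 2 * V) with hl
  have hl0 : 0 ≤ l := by positivity
  have hmgf := sum_embedding_exp_le a ha hR k hk (fun j => l * z j)
  have hsq : ∑ j, (l * z j) ^ 2 = l ^ 2 * V := by simp only [mul_pow, hV, Finset.mul_sum]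
  have hC : 40 * (k : ℝ) / Fintype.card ι ≤ 2 := by
    refine div_le_of_le_mul₀ (by positivity) (by norm_num) ?_
    have : (20 * k : ℝ) ≤ Fintype.card ι := by exact_mod_cast hk
    linarith
  have hmarkov : ((Finset.univ.filter fun f : Fin k ↪ ι => t < ∑ j, z j * a (f j)).card : ℝ) *
      Real.exp (l * t) ≤ ∑ f : Fin k ↪ ι, Real.exp (∑ j, l * z j * a (f j)) := by
    rw [← nsmul_eq_mul, ← Finset.sum_const]
    refine (Finset.sum_le_sum fun f hf => ?_).trans
      (Finset.sum_le_univ_sum_of_nonneg fun f => (Real.exp_pos _).le)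
    simp only [mul_assoc, ← Finset.mul_sum]
    have := (Finset.mem_filter.1 hf).2
    gcongr
  have hle : Real.exp ((2 + 40 * k / Fintype.card ι) * (R ^ 2 / 2) * (l ^ 2 * V)) ≤
      Real.exp (4 * (R ^ 2 / 2) * (l ^ 2 * V)) := by
    gcongr
    linarith
  have hid : Real.exp (4 * (R ^ 2 / 2) * (l ^ 2 * V)) =
      Real.exp (-(t ^ 2 / (8 * R ^ 2 * V))) * Real.exp (l * t) := by
    rw [← Real.exp_add, hl]
    congr 1
    field_simp
    ring
  rw [hsq] at hmgf
  refine le_of_mul_le_mul_right (hmarkov.trans (hmgf.trans ?_)) (Real.exp_pos (l * t))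
  rw [mul_assoc (Fintype.card _ : ℝ), ← hid]
  exact mul_le_mul_of_nonneg_left hle (by positivity)

/-- Two-sided tail of a weighted sum over a uniformly random injection, around its mean. -/
theorem card_embedding_lt_abs_le {ι : Type*} [Fintype ι] [DecidableEq ι] [Nonempty ι] (a : ι → ℝ)
    {R : ℝ} (hR : ∀ i j, |a i - a j| ≤ R) (hR0 : 0 < R) {k : ℕ}
    (hk : 20 * k ≤ Fintype.card ι) (z : Fin k → ℝ) (hz : 0 < ∑ j, z j ^ 2) {s t : ℝ} (ht : 0 ≤ t)
    (hs : |(∑ i, a i) / Fintype.card ι * ∑ j, z j| ≤ s) :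
    ((Finset.univ.filter fun f : Fin k ↪ ι => s + t < |∑ j, z j * a (f j)|).card : ℝ) ≤
      2 * (Fintype.card (Fin k ↪ ι) * Real.exp (-(t ^ 2 / (8 * R ^ 2 * ∑ j, z j ^ 2)))) := by
  set m := (∑ i, a i) / Fintype.card ι with hm
  have hp : (Fintype.card ι : ℝ) ≠ 0 := by exact_mod_cast Fintype.card_ne_zero
  have hb : ∑ i, (a i - m) = 0 := by
    simp [Finset.sum_sub_distrib, hm]; field_simp; simp
  have hb' : ∑ i, (m - a i) = 0 := by
    simp only [Finset.sum_sub_distrib] at hb ⊢; linarith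
  have h1 := card_embedding_lt_sum_le (fun i => a i - m) hb
    (fun i j => by simpa using hR i j) hR0 hk z hz ht
  have h2 := card_embedding_lt_sum_le (fun i => m - a i) hb'
    (fun i j => by simpa using hR j i) hR0 hk z hz ht
  have hsub : (Finset.univ.filter fun f : Fin k ↪ ι => s + t < |∑ j, z j * a (f j)|) ⊆
      (Finset.univ.filter fun f : Fin k ↪ ι => t < ∑ j, z j * (a (f j) - m)) ∪
      (Finset.univ.filter fun f : Fin k ↪ ι => t < ∑ j, z j * (m - a (f j))) := by
    intro f hf
    simp only [Finset.mem_filter, Finset.mem_univ, true_and, Finset.mem_union, mul_sub,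
      Finset.sum_sub_distrib, ← Finset.sum_mul] at hf ⊢
    have := abs_le.1 hs
    rw [mul_comm] at this
    rcases lt_abs.1 hf with h | h
    · left; linarith
    · right; linarith
  have h3 : ((Finset.univ.filter fun f : Fin k ↪ ι => s + t < |∑ j, z j * a (f j)|).card : ℝ) ≤
      (Finset.univ.filter fun f : Fin k ↪ ι => t < ∑ j, z j * (a (f j) - m)).card +
      (Finset.univ.filter fun f : Fin k ↪ ι => t < ∑ j, z j * (m - a (f j))).card := by
    exact_mod_cast (Finset.card_le_card hsub).trans (Finset.card_union_le _ _)
  linarith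

/-! ### Coherence and the Welch bound. -/

theorem UnitColumns.dotProduct_self {n p : ℕ} {X : Matrix (Fin n) (Fin p) ℝ} (h : UnitColumns X)
    (i : Fin p) : X.col i ⬝ᵥ X.col i = 1 := by
  have h1 := h i
  rw [EuclideanSpace.norm_eq, Real.sqrt_eq_one] at h1
  rw [← h1]
  simp [dotProduct, sq]

theorem abs_dotProduct_le_worstCoherence {n p : ℕ} (X : Matrix (Fin n) (Fin p) ℝ) {i j : Fin p}
    (hij : i ≠ j) : |X.col i ⬝ᵥ X.col j| ≤ worstCoherence X :=
  le_ciSup (f := fun q : {q : Fin p × Fin p // q.1 ≠ q.2} => |X.col q.1.1 ⬝ᵥ X.col q.1.2|)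
    (Set.finite_range _).bddAbove ⟨(i, j), hij⟩

theorem worstCoherence_nonneg {n p : ℕ} (X : Matrix (Fin n) (Fin p) ℝ) : 0 ≤ worstCoherence X :=
  Real.iSup_nonneg fun _ => abs_nonneg _

theorem abs_sum_dotProduct_le_averageCoherence {n p : ℕ} (X : Matrix (Fin n) (Fin p) ℝ)
    (hp : 1 < p) (i : Fin p) :
    |∑ j ∈ Finset.univ.erase i, X.col i ⬝ᵥ X.col j| ≤ ((p : ℝ) - 1) * averageCoherence X := by
  have hp' : (0 : ℝ) < p - 1 := by
    have : (1 : ℝ) < p := by exact_mod_cast hp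
    linarith
  rw [averageCoherence, ← mul_assoc, mul_one_div_cancel hp'.ne', one_mul]
  exact le_ciSup (f := fun i : Fin p => |∑ j ∈ Finset.univ.erase i, X.col i ⬝ᵥ X.col j|)
    (Set.finite_range _).bddAbove i

theorem averageCoherence_nonneg {n p : ℕ} (X : Matrix (Fin n) (Fin p) ℝ) (hp : 1 < p) :
    0 ≤ averageCoherence X := by
  have hp' : (1 : ℝ) < p := by exact_mod_cast hp
  exact mul_nonneg (one_div_nonneg.2 (by linarith)) (Real.iSup_nonneg fun _ => abs_nonneg _)

/-- A form of the Welch bound: `p² ≤ n ‖Xᵀ X‖²` in Frobenius norm. -/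
theorem UnitColumns.sq_le_mul_sum_gram {n p : ℕ} {X : Matrix (Fin n) (Fin p) ℝ}
    (h : UnitColumns X) :
    (p : ℝ) ^ 2 ≤ n * ∑ i, ∑ j, (X.col i ⬝ᵥ X.col j) ^ 2 := by
  have htr : ∑ r, ∑ i, X r i ^ 2 = p := by
    rw [Finset.sum_comm]
    have : ∀ i, ∑ r, X r i ^ 2 = 1 := fun i => by
      rw [← h.dotProduct_self i]; simp [dotProduct, sq]
    simp [this]
  -- `Xᵀ X` and `X Xᵀ` have equal Frobenius norms; the latter has only `n` diagonal entries, with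
  -- sum `p`, so Cauchy–Schwarz on them suffices.
  have hfrob : ∑ i, ∑ j, (X.col i ⬝ᵥ X.col j) ^ 2 = ∑ r, ∑ s, (∑ i, X r i * X s i) ^ 2 := by
    simp only [dotProduct, Matrix.col_apply, sq, Finset.sum_mul_sum]
    calc _ = ∑ i, ∑ r, ∑ s, ∑ j, X r i * X r j * (X s i * X s j) := by
          refine Finset.sum_congr rfl fun i _ => ?_
          rw [Finset.sum_comm]
          exact Finset.sum_congr rfl fun r _ => Finset.sum_comm
      _ = ∑ r, ∑ s, ∑ i, ∑ j, X r i * X r j * (X s i * X s j) := by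
          rw [Finset.sum_comm]
          exact Finset.sum_congr rfl fun r _ => Finset.sum_comm
      _ = _ := by
          refine Finset.sum_congr rfl fun r _ => Finset.sum_congr rfl fun s _ =>
            Finset.sum_congr rfl fun i _ => Finset.sum_congr rfl fun j _ => by ring
  calc (p : ℝ) ^ 2 = (∑ r, ∑ i, X r i ^ 2) ^ 2 := by rw [htr]
    _ ≤ n * ∑ r, (∑ i, X r i ^ 2) ^ 2 := by
        simpa using sq_sum_le_card_mul_sum_sq (s := Finset.univ) (f := fun r => ∑ i, X r i ^ 2)
    _ ≤ n * ∑ r, ∑ s, (∑ i, X r i * X s i) ^ 2 := by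
        gcongr with r
        refine le_trans (le_of_eq ?_) (Finset.single_le_sum
          (f := fun s => (∑ i, X r i * X s i) ^ 2) (fun s _ => sq_nonneg _) (Finset.mem_univ r))
        simp [sq]
    _ = _ := by rw [hfrob]

/-- Bounding the squared Gram entries by 1 on the diagonal and `μ²` elsewhere, the Welch bound gives
`p ≤ n (1 + p μ²)`; then `n ≤ p / 2` absorbs the first term. -/
theorem UnitColumns.one_le_mul_worstCoherence_sq {n p : ℕ} {X : Matrix (Fin n) (Fin p) ℝ}
    (h : UnitColumns X) (hp : 0 < p) (hpn : 2 * n ≤ p) :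
    1 ≤ 2 * n * worstCoherence X ^ 2 := by
  set μ := worstCoherence X with hμ
  have hp' : (0 : ℝ) < p := by exact_mod_cast hp
  have hpn' : (2 : ℝ) * n ≤ p := by exact_mod_cast hpn
  have hrow (i : Fin p) : ∑ j, (X.col i ⬝ᵥ X.col j) ^ 2 ≤ 1 + p * μ ^ 2 := by
    calc ∑ j, (X.col i ⬝ᵥ X.col j) ^ 2 ≤ ∑ j, ((if i = j then 1 else 0) + μ ^ 2) := by
          refine Finset.sum_le_sum fun j _ => ?_
          split_ifs with hij
          · rw [← hij, h.dotProduct_self]; nlinarith [sq_nonneg μ]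
          · rw [← sq_abs, zero_add]
            exact pow_le_pow_left₀ (abs_nonneg _) (abs_dotProduct_le_worstCoherence X hij) 2
      _ = _ := by simp [Finset.sum_add_distrib]
  have hw := h.sq_le_mul_sum_gram
  have hs : ∑ i, ∑ j, (X.col i ⬝ᵥ X.col j) ^ 2 ≤ p * (1 + p * μ ^ 2) := by
    simpa [mul_add] using Finset.sum_le_sum fun i (_ : i ∈ Finset.univ) => hrow i
  have h1 : (p : ℝ) ^ 2 ≤ n * (p * (1 + p * μ ^ 2)) := hw.trans (by gcongr)
  have h2 : (p : ℝ) * (p * 1) ≤ p * (p * (2 * n * μ ^ 2)) := by nlinarith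
  exact le_of_mul_le_mul_left (le_of_mul_le_mul_left h2 hp') hp'

/-! ### Probability tools: Gaussian tails and uniform laws. -/

theorem hasSubgaussianMGF_of_hasLaw_gaussianReal {Ω : Type*} [MeasurableSpace Ω] {P : Measure Ω}
    {Y : Ω → ℝ} {v : ℝ≥0} (h : HasLaw Y (gaussianReal 0 v) P) : HasSubgaussianMGF Y v P where
  integrable_exp_mul t := by
    have h1 := integrable_exp_mul_gaussianReal (μ := 0) (v := v) t
    rw [← h.map_eq] at h1
    exact (integrable_map_measure h1.aestronglyMeasurable h.aemeasurable).1 h1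
  mgf_le t := by rw [mgf_gaussianReal h.map_eq t]; simp

/-- Two-sided tail of a normalized linear combination of independent centred Gaussians, also in
the degenerate case of variance zero. -/
theorem measure_abs_dotProduct_gaussian_le {Ω : Type*} [MeasurableSpace Ω] (P : Measure Ω)
    [IsProbabilityMeasure P] {n : ℕ} (x : Fin n → ℝ) (hx : x ⬝ᵥ x = 1) (σ : ℝ≥0)
    (η : Ω → Fin n → ℝ) (hη : ∀ r, HasLaw (fun ω => η ω r) (gaussianReal 0 (σ ^ 2)) P)
    (hind : iIndepFun (fun r ω => η ω r) P) {l : ℝ} (hl : 0 ≤ l) :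
    P.real {ω | 2 * √((σ : ℝ) ^ 2 * l) < |x ⬝ᵥ η ω|} ≤ 2 * Real.exp (-(2 * l)) := by
  have hsub : HasSubgaussianMGF (fun ω => x ⬝ᵥ η ω) (σ ^ 2) P := by
    have h1 : iIndepFun (fun r ω => x r * η ω r) P :=
      hind.comp (fun r y => x r * y) fun r => by fun_prop
    have h2 := HasSubgaussianMGF.sum_of_iIndepFun h1 (s := Finset.univ)
      (c := fun r => NNReal.mk (x r ^ 2) (sq_nonneg _) * σ ^ 2)
      fun r _ => (hasSubgaussianMGF_of_hasLaw_gaussianReal (hη r)).const_mul (x r)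
    have h3 : ∑ r, NNReal.mk (x r ^ 2) (sq_nonneg _) = 1 := by
      apply NNReal.coe_injective
      rw [NNReal.coe_sum, NNReal.coe_one, ← hx]
      exact Finset.sum_congr rfl fun r _ => sq _
    rw [← Finset.sum_mul, h3, one_mul] at h2
    exact h2
  -- For `σ = 0` the Chernoff exponent is `0 / 0 = 0` and says nothing; the noise vanishes almost
  -- surely instead.
  rcases eq_or_ne σ 0 with rfl | hσ
  · rw [zero_pow two_ne_zero] at hsub
    have h0 : P {ω | 2 * √(((0 : ℝ≥0) : ℝ) ^ 2 * l) < |x ⬝ᵥ η ω|} = 0 := by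
      refine measure_mono_null (fun ω hω => ?_) hsub.ae_eq_zero_of_hasSubgaussianMGF_zero
      intro h
      have h' : x ⬝ᵥ η ω = 0 := h
      simp [h'] at hω
    rw [measureReal_def, h0, ENNReal.toReal_zero]
    positivity
  · have hσ' : (0 : ℝ) < (σ : ℝ) ^ 2 := by positivity
    set ε := 2 * √((σ : ℝ) ^ 2 * l) with hε
    have hε0 : 0 ≤ ε := by positivity
    have hexp : Real.exp (-ε ^ 2 / (2 * ((σ ^ 2 : ℝ≥0) : ℝ))) = Real.exp (-(2 * l)) := by
      congr 1
      rw [hε, mul_pow, Real.sq_sqrt (by positivity)]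
      push_cast
      field_simp
    have h1 := hsub.measure_ge_le hε0
    have h2 := hsub.neg.measure_ge_le hε0
    rw [hexp] at h1 h2
    calc P.real {ω | ε < |x ⬝ᵥ η ω|}
        ≤ P.real ({ω | ε ≤ x ⬝ᵥ η ω} ∪ {ω | ε ≤ (-fun ω => x ⬝ᵥ η ω) ω}) := by
          refine measureReal_mono fun ω hω => ?_
          rcases lt_abs.1 (show ε < |x ⬝ᵥ η ω| from hω) with h | h
          · exact Or.inl h.le
          · exact Or.inr h.le
      _ ≤ _ := measureReal_union_le _ _
      _ ≤ _ := by linarith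

theorem IsUniform.measure_mem_le {Ω α : Type*} [MeasurableSpace Ω] {P : Measure Ω} {Y : Ω → α}
    (h : IsUniform P Y) (s : Finset α) : P.real {ω | Y ω ∈ s} ≤ s.card / (Nat.card α : ℝ) := by
  have : {ω | Y ω ∈ s} = ⋃ a ∈ s, {ω | Y ω = a} := by ext ω; simp
  rw [this]
  refine (measureReal_biUnion_finset_le _ _).trans_eq ?_
  simp [(h _).2, div_eq_mul_inv]

/-! ### Marginal correlations and the deterministic screening criterion. -/

/-- The `i`-th row of the Gram matrix with its diagonal entry replaced by zero. -/
noncomputable def hollowGram {n p : ℕ} (X : Matrix (Fin n) (Fin p) ℝ) (i l : Fin p) : ℝ :=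
  if l = i then 0 else X.col i ⬝ᵥ X.col l

theorem signal_apply {k p : ℕ} (z : EuclideanSpace ℝ (Fin k)) (f : Fin k ↪ Fin p) (i : Fin p) :
    signal z f i = ∑ j, if i = f j then z j else 0 := by
  simp [signal, Pi.single_apply]

theorem signal_apply_self {k p : ℕ} (z : EuclideanSpace ℝ (Fin k)) (f : Fin k ↪ Fin p)
    (j : Fin k) : signal z f (f j) = z j := by
  simp [signal_apply]

theorem mem_supp {p : ℕ} {β : EuclideanSpace ℝ (Fin p)} {i : Fin p} : i ∈ supp β ↔ β i ≠ 0 := by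
  simp [supp]

theorem exists_of_mem_supp_signal {k p : ℕ} {z : EuclideanSpace ℝ (Fin k)} {f : Fin k ↪ Fin p}
    {i : Fin p} (h : i ∈ supp (signal z f)) : ∃ j, f j = i := by
  by_contra! hne
  refine mem_supp.1 h ?_
  rw [signal_apply]
  exact Finset.sum_eq_zero fun j _ => if_neg (hne j).symm

theorem card_supp_signal_le {k p : ℕ} (z : EuclideanSpace ℝ (Fin k)) (f : Fin k ↪ Fin p) :
    (supp (signal z f)).card ≤ k := by
  have h : supp (signal z f) ⊆ Finset.univ.map f := fun i hi => by
    simpa using exists_of_mem_supp_signal hi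
  simpa using Finset.card_le_card h

/-- The unit diagonal of the Gram matrix contributes exactly `signal z f i`. Zeroing the diagonal
lets one formula serve both active and inactive `i`. -/
theorem correlation_eq {n p k : ℕ} {X : Matrix (Fin n) (Fin p) ℝ} (hX : UnitColumns X)
    (z : EuclideanSpace ℝ (Fin k)) (f : Fin k ↪ Fin p) (e : Fin n → ℝ) (i : Fin p) :
    (Xᵀ *ᵥ (X *ᵥ (signal z f).ofLp + e)) i =
      signal z f i + ∑ j, z j * hollowGram X i (f j) + X.col i ⬝ᵥ e := by
  have h1 : (Xᵀ *ᵥ (X *ᵥ (signal z f).ofLp + e)) i =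
      X.col i ⬝ᵥ (X *ᵥ (signal z f).ofLp) + X.col i ⬝ᵥ e := by
    rw [← dotProduct_add]; rfl
  have h2 : X.col i ⬝ᵥ (X *ᵥ (signal z f).ofLp) = ∑ l, (X.col i ⬝ᵥ X.col l) * signal z f l := by
    rw [Matrix.dotProduct_mulVec]; rfl
  rw [h1, h2]
  congr 1
  simp only [signal_apply, Finset.mul_sum, mul_ite, mul_zero]
  rw [Finset.sum_comm, ← Finset.sum_add_distrib]
  refine Finset.sum_congr rfl fun j _ => ?_
  rw [Finset.sum_ite_eq' Finset.univ (f j)]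
  simp only [Finset.mem_univ, if_true, hollowGram]
  by_cases h : i = f j
  · simp [← h, hX.dotProduct_self]
  · simp [h, Ne.symm h, mul_comm]

theorem supp_subset_of_isScreeningOutput {n p k d : ℕ} {X : Matrix (Fin n) (Fin p) ℝ}
    (hX : UnitColumns X) {z : EuclideanSpace ℝ (Fin k)} {b τ ε : ℝ} (hb : ∀ j, b ≤ |z j|)
    (hlt : 2 * (τ + ε) < b) (hd : k ≤ d) {f : Fin k ↪ Fin p} {e : Fin n → ℝ}
    (hT : ∀ i, |∑ j, z j * hollowGram X i (f j)| ≤ τ) (he : ∀ i, |X.col i ⬝ᵥ e| ≤ ε)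
    {S : Finset (Fin p)} (hS : IsScreeningOutput X (X *ᵥ (signal z f).ofLp + e) d S) :
    supp (signal z f) ⊆ S := by
  intro i hi
  by_contra hiS
  -- Counting: otherwise `S` would be a proper subset of the support, so `d < k`. Such an `l` has
  -- `|w l| ≤ τ + ε < b - τ - ε ≤ |w i|`, against the ranking.
  obtain ⟨l, hlS, hl⟩ : ∃ l ∈ S, l ∉ supp (signal z f) := by
    by_contra! h
    have hsub : S ⊂ supp (signal z f) := (Finset.ssubset_iff_of_subset h).2 ⟨i, hi, hiS⟩
    have := Finset.card_lt_card hsub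
    have := card_supp_signal_le z f
    have := hS.1
    omega
  have hle := hS.2 l hlS i hiS
  rw [correlation_eq hX, correlation_eq hX] at hle
  have hl0 : signal z f l = 0 := by simpa [mem_supp] using hl
  obtain ⟨j, rfl⟩ := exists_of_mem_supp_signal hi
  rw [signal_apply_self, hl0, zero_add] at hle
  have h1 := abs_add_le (∑ j, z j * hollowGram X l (f j)) (X.col l ⬝ᵥ e)
  have h2 := abs_sub_abs_le_abs_sub (z j)
    (-(∑ j', z j' * hollowGram X (f j) (f j') + X.col (f j) ⬝ᵥ e))
  rw [sub_neg_eq_add, abs_neg, ← add_assoc] at h2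
  have h3 := abs_add_le (∑ j', z j' * hollowGram X (f j) (f j')) (X.col (f j) ⬝ᵥ e)
  linarith [hT l, he l, hT (f j), he (f j), hb j]

theorem abs_hollowGram_le {n p : ℕ} (X : Matrix (Fin n) (Fin p) ℝ) (i l : Fin p) :
    |hollowGram X i l| ≤ worstCoherence X := by
  unfold hollowGram
  split_ifs with h
  · simpa using worstCoherence_nonneg X
  · exact abs_dotProduct_le_worstCoherence X (Ne.symm h)

theorem sum_hollowGram {n p : ℕ} (X : Matrix (Fin n) (Fin p) ℝ) (i : Fin p) :
    ∑ l, hollowGram X i l = ∑ j ∈ Finset.univ.erase i, X.col i ⬝ᵥ X.col j := by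
  rw [← Finset.add_sum_erase _ _ (Finset.mem_univ i)]
  simp only [hollowGram, if_true, zero_add]
  exact Finset.sum_congr rfl fun j hj => if_neg (Finset.ne_of_mem_erase hj)

/-! ### Consequences of the coherence property. -/

section Coherence

variable {n p k : ℕ} {X : Matrix (Fin n) (Fin p) ℝ} {c : ℝ}

/-- The strict inequality `ν < μ / √n` with `ν ≥ 0` excludes `μ = 0`. -/
theorem CoherenceProperty.worstCoherence_pos (hX : CoherenceProperty X c) (hp : 1 < p) :
    0 < worstCoherence X := by
  refine (worstCoherence_nonneg X).lt_of_ne fun h => ?_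
  have h1 := hX.2.2.2
  rw [← h, zero_div] at h1
  exact absurd (averageCoherence_nonneg X hp) h1.not_ge

theorem CoherenceProperty.sparsity_le (hX : CoherenceProperty X c)
    (hp : 1 < p) (hpn : 2 * n ≤ p) (hlog : 5 ≤ Real.log p)
    (hk : (k : ℝ) < (worstCoherence X ^ 2)⁻¹ / (c ^ 2 * Real.log p)) :
    k * (c ^ 2 * Real.log p) ≤ 2 * n := by
  have hμ := hX.worstCoherence_pos hp
  have hw := hX.1.one_le_mul_worstCoherence_sq (by omega) hpn
  have hc0 : 0 < c := hX.2.1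
  rw [lt_div_iff₀ (by positivity)] at hk
  refine hk.le.trans ?_
  rw [inv_le_iff_one_le_mul₀ (by positivity)]
  linarith

/-- The row mean is at most `ν < μ / √n`, while Cauchy–Schwarz and `k ≤ n` give `|∑ z j| ≤ √n ‖z‖`;
the factors `√n` cancel. -/
theorem CoherenceProperty.abs_mean_le (hX : CoherenceProperty X c) (hc : 10 * √2 < c)
    (hp : 1 < p) (hpn : 2 * n ≤ p) (hlog : 5 ≤ Real.log p)
    (hk : (k : ℝ) < (worstCoherence X ^ 2)⁻¹ / (c ^ 2 * Real.log p))
    (z : EuclideanSpace ℝ (Fin k)) (i : Fin p) :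
    |(∑ l, hollowGram X i l) / Fintype.card (Fin p) * ∑ j, z j| ≤ worstCoherence X * ‖z‖ := by
  have hμ := hX.worstCoherence_pos hp
  have hp' : (1 : ℝ) < p := by exact_mod_cast hp
  have hc2 : 200 < c ^ 2 := by
    have := pow_lt_pow_left₀ hc (by positivity) two_ne_zero
    rw [mul_pow, Real.sq_sqrt (by norm_num)] at this
    linarith
  have hkn : (k : ℝ) ≤ n := by
    have h1 := hX.sparsity_le hp hpn hlog hk
    have h2 : (2 : ℝ) ≤ c ^ 2 * Real.log p := by nlinarith
    nlinarith [(Nat.cast_nonneg k : (0 : ℝ) ≤ k)]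
  have hn : (0 : ℝ) < n := by
    have := hX.1.one_le_mul_worstCoherence_sq (by omega) hpn
    by_contra! h
    nlinarith [sq_nonneg (worstCoherence X)]
  have hz : |∑ j, z j| ≤ √n * ‖z‖ := by
    refine abs_le_of_sq_le_sq ?_ (by positivity)
    rw [mul_pow, Real.sq_sqrt hn.le, EuclideanSpace.real_norm_sq_eq]
    have h := sq_sum_le_card_mul_sum_sq (s := Finset.univ) (f := fun j => z j)
    rw [Finset.card_univ, Fintype.card_fin] at h
    exact h.trans (by gcongr)
  have hm : |(∑ l, hollowGram X i l) / (p : ℝ)| ≤ worstCoherence X / √n := by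
    rw [abs_div, abs_of_pos (by linarith : (0 : ℝ) < p), div_le_iff₀ (by linarith), sum_hollowGram]
    have h1 := abs_sum_dotProduct_le_averageCoherence X hp i
    have h2 := averageCoherence_nonneg X hp
    nlinarith [hX.2.2.2]
  rw [abs_mul, Fintype.card_fin]
  calc _ ≤ worstCoherence X / √n * (√n * ‖z‖) := by gcongr
    _ = _ := by
      have : √(n : ℝ) ≠ 0 := by positivity
      field_simp

/-- For a uniformly random support, the correlation of a fixed column with the other active
columns is unlikely to be large. -/
theorem CoherenceProperty.card_lt_abs_sum_hollowGram_le (hX : CoherenceProperty X c)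
    (hc : 10 * √2 < c) (hp : 1 < p) (hpn : 2 * n ≤ p) (hlog : 5 ≤ Real.log p)
    (hk : (k : ℝ) < (worstCoherence X ^ 2)⁻¹ / (c ^ 2 * Real.log p))
    (z : EuclideanSpace ℝ (Fin k)) (hz : z ≠ 0) (i : Fin p) :
    ((Finset.univ.filter fun f : Fin k ↪ Fin p => c * worstCoherence X * √(Real.log p) * ‖z‖ <
      |∑ j, z j * hollowGram X i (f j)|).card : ℝ) ≤
      2 * (Nat.card (Fin k ↪ Fin p) * Real.exp (-(2 * Real.log p))) := by
  set μ := worstCoherence X with hμdef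
  have hμ : 0 < μ := hX.worstCoherence_pos hp
  have hc14 : 14 ≤ c := by
    have : (1.4 : ℝ) ≤ √2 := Real.le_sqrt_of_sq_le (by norm_num)
    linarith
  have hk20 : 20 * k ≤ p := by
    have h1 := hX.sparsity_le hp hpn hlog hk
    have h2 : (20 : ℝ) ≤ c ^ 2 * Real.log p := by nlinarith
    have h3 : (2 * n : ℝ) ≤ p := by exact_mod_cast hpn
    have h4 : (20 * k : ℝ) ≤ p := by nlinarith [(Nat.cast_nonneg k : (0 : ℝ) ≤ k)]
    exact_mod_cast h4
  have hz0 : 0 < ‖z‖ := norm_pos_iff.2 hz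
  have hnorm : ∑ j, z j ^ 2 = ‖z‖ ^ 2 := (EuclideanSpace.real_norm_sq_eq z).symm
  have hL : 1 ≤ √(Real.log p) := Real.one_le_sqrt.2 (by linarith)
  have : Nonempty (Fin p) := ⟨i⟩
  -- With `R = 2 μ`, the factor 8 makes the tail exponent `64 / 32 * log p = 2 log p`. Adding the
  -- mean `μ ‖z‖` costs at most one more unit, and `9 ≤ 14 ≤ c`.
  set t := 8 * μ * √(Real.log p) * ‖z‖ with ht
  have h := card_embedding_lt_abs_le (hollowGram X i) (R := 2 * μ)
    (fun a b => (abs_sub _ _).trans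
      (by linarith [abs_hollowGram_le X i a, abs_hollowGram_le X i b])) (by positivity)
    (by simpa using hk20) (fun j => z j) (by rw [hnorm]; positivity)
    (t := t) (by positivity) (hX.abs_mean_le hc hp hpn hlog hk z i)
  have hexp : t ^ 2 / (8 * (2 * μ) ^ 2 * ∑ j, z j ^ 2) = 2 * Real.log p := by
    rw [hnorm, ht, mul_pow, mul_pow, Real.sq_sqrt (by linarith)]
    field_simp
    norm_num
  rw [hexp] at h
  rw [Nat.card_eq_fintype_card]
  refine le_trans ?_ h
  have hthr : μ * ‖z‖ + t ≤ c * μ * √(Real.log p) * ‖z‖ := by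
    have h1 : μ * ‖z‖ * 1 ≤ μ * ‖z‖ * √(Real.log p) := by gcongr
    have h2 : 14 * (μ * ‖z‖ * √(Real.log p)) ≤ c * (μ * ‖z‖ * √(Real.log p)) := by gcongr
    have h3 : 0 ≤ μ * ‖z‖ * √(Real.log p) := by positivity
    rw [ht]
    linarith
  exact_mod_cast Finset.card_le_card
    (Finset.monotone_filter_right _ fun f _ hf => hthr.trans_lt hf)

end Coherence

/-! ### Output size and the final union bound. -/

/-- Since `√k * b ≤ ‖z‖` and `r ≥ 0`, the denominator is at most `1 / √k`, so the quotient is at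
least `k`. -/
theorem le_of_ceil_sqrt_div_le {k d : ℕ} (hk : 1 ≤ k) {z : EuclideanSpace ℝ (Fin k)} {b r : ℝ}
    (hb0 : 0 ≤ b) (hb : ∀ j, b ≤ |z j|) (hr : 0 ≤ r) (hrb : 0 < b / ‖z‖ - r)
    (hd : ⌈√(k : ℝ) / (b / ‖z‖ - r)⌉₊ ≤ d) : k ≤ d := by
  have hk' : (0 : ℝ) < k := by exact_mod_cast hk
  have hz : 0 < ‖z‖ := by
    refine (norm_nonneg z).lt_of_ne fun h => ?_
    rw [← h, div_zero] at hrb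
    linarith
  have hsq : √(k : ℝ) * b ≤ ‖z‖ := by
    refine (pow_le_pow_iff_left₀ (by positivity) hz.le two_ne_zero).1 ?_
    rw [mul_pow, Real.sq_sqrt hk'.le, EuclideanSpace.real_norm_sq_eq]
    calc (k : ℝ) * b ^ 2 = ∑ _j : Fin k, b ^ 2 := by simp
      _ ≤ ∑ j, z j ^ 2 := by
        refine Finset.sum_le_sum fun j _ => ?_
        rw [← sq_abs (z j)]
        exact pow_le_pow_left₀ hb0 (hb j) 2
  have h1 : (k : ℝ) ≤ √(k : ℝ) / (b / ‖z‖ - r) := by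
    rw [le_div_iff₀ hrb]
    calc (k : ℝ) * (b / ‖z‖ - r) ≤ k * (b / ‖z‖) := by gcongr; linarith
      _ = √(k : ℝ) * (√(k : ℝ) * b / ‖z‖) := by
        rw [← mul_div_assoc, ← mul_div_assoc, ← mul_assoc, Real.mul_self_sqrt hk'.le]
      _ ≤ √(k : ℝ) * 1 := by
        gcongr
        exact (div_le_one hz).2 hsq
      _ = _ := mul_one _
  exact Nat.cast_le.1 (h1.trans ((Nat.le_ceil _).trans (Nat.cast_le.2 hd)))

end ExSIS

open ExSIS

theorem theorem4 {Ω : Type*} [MeasurableSpace Ω] (P : Measure Ω) [IsProbabilityMeasure P]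
    (n p k d : ℕ) (hk : 1 ≤ k)
    (X : Matrix (Fin n) (Fin p) ℝ) (c : ℝ)
    (hX : ExSIS.CoherenceProperty X c) (hc : 10 * √2 < c)
    -- the `k` nonzero values of the parameter vector, and their smallest absolute value
    (z : EuclideanSpace ℝ (Fin k)) (hz : ∀ j, z j ≠ 0)
    (βmin : ℝ) (hβmin : IsLeast (Set.range fun j => |z j|) βmin)
    -- the random positions of these values
    (π : Ω → (Fin k ↪ Fin p)) (hπ : ExSIS.IsUniform P π)
    -- the noise
    (σ : ℝ≥0) (η : Ω → Fin n → ℝ)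
    (hη : ∀ r, HasLaw (fun ω => η ω r) (gaussianReal 0 (σ ^ 2)) P)
    (hηindep : iIndepFun (fun r ω => η ω r) P)
    (hpn : 2 * n ≤ p) (hp5 : Real.exp 5 ≤ p)
    (hkμ : (k : ℝ) < (ExSIS.worstCoherence X ^ 2)⁻¹ / (c ^ 2 * Real.log p))
    (hβ : 2 * c * ExSIS.worstCoherence X * √(Real.log p)
        + 4 * √((σ : ℝ) ^ 2 * Real.log p) / ‖z‖ < βmin / ‖z‖)
    (hdp : d ≤ p)
    (hd : ⌈√(k : ℝ) / (βmin / ‖z‖ - 2 * c * ExSIS.worstCoherence X * √(Real.log p)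
        - 4 * √((σ : ℝ) ^ 2 * Real.log p) / ‖z‖)⌉₊ ≤ d) :
    1 - 6 / (p : ℝ) <
      P.real {ω | ∀ S : Finset (Fin p),
        ExSIS.IsScreeningOutput X (X *ᵥ (ExSIS.signal z (π ω)).ofLp + η ω) d S →
          ExSIS.supp (ExSIS.signal z (π ω)) ⊆ S} := by
  set μ := worstCoherence X with hμ
  set L := Real.log p with hL
  have hp0 : (0 : ℝ) < p := (Real.exp_pos 5).trans_le hp5
  have hL5 : 5 ≤ L := (Real.le_log_iff_exp_le hp0).2 hp5
  have hp1 : 1 < p := by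
    have h : (5 : ℝ) + 1 ≤ p := (Real.add_one_le_exp 5).trans hp5
    have : (1 : ℝ) < p := by linarith
    exact_mod_cast this
  have hb (j : Fin k) : βmin ≤ |z j| := hβmin.2 ⟨j, rfl⟩
  have hb0 : 0 ≤ βmin := by
    obtain ⟨j, hj⟩ := hβmin.1
    exact hj ▸ abs_nonneg (z j)
  have hz0 : z ≠ 0 := fun h => hz ⟨0, hk⟩ (by simp [h])
  have hnz : 0 < ‖z‖ := norm_pos_iff.2 hz0
  have hc0 : 0 < c := hX.2.1
  have hμ0 : 0 ≤ μ := worstCoherence_nonneg X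
  have hkd : k ≤ d := by
    refine le_of_ceil_sqrt_div_le hk hb0 hb (r := 2 * c * μ * √L + 4 * √((σ : ℝ) ^ 2 * L) / ‖z‖)
      (by positivity) (by linarith) ?_
    rwa [← sub_sub]
  set τ := c * μ * √L * ‖z‖ with hτ
  set ε := 2 * √((σ : ℝ) ^ 2 * L) with hε
  have hlt : 2 * (τ + ε) < βmin := by
    have h := mul_lt_mul_of_pos_right hβ hnz
    rw [add_mul, div_mul_cancel₀ _ hnz.ne', div_mul_cancel₀ _ hnz.ne'] at h
    rw [hτ, hε]
    linarith
  set B : Fin p → Finset (Fin k ↪ Fin p) := fun i =>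
    Finset.univ.filter fun f => τ < |∑ j, z j * hollowGram X i (f j)| with hB
  set G := {ω | ∀ S : Finset (Fin p), IsScreeningOutput X (X *ᵥ (signal z (π ω)).ofLp + η ω) d S →
    supp (signal z (π ω)) ⊆ S} with hG
  have hexp : Real.exp (-(2 * L)) = 1 / (p : ℝ) ^ 2 := by
    rw [Real.exp_neg, two_mul, Real.exp_add, hL, Real.exp_log hp0, one_div, sq]
  -- Covering the whole space and using subadditivity bounds the measure of `G` from below without
  -- showing that `G` is measurable.
  have hcover : Set.univ ⊆ G ∪
      ⋃ i ∈ (Finset.univ : Finset (Fin p)), ({ω | π ω ∈ B i} ∪ {ω | ε < |X.col i ⬝ᵥ η ω|}) := by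
    intro ω _
    by_cases h : ω ∈ ⋃ i ∈ (Finset.univ : Finset (Fin p)),
      ({ω | π ω ∈ B i} ∪ {ω | ε < |X.col i ⬝ᵥ η ω|})
    · exact Or.inr h
    · left
      simp only [Finset.mem_univ, Set.iUnion_true, Set.mem_iUnion, Set.mem_union,
        Set.mem_ofPred_eq, not_exists, not_or, not_lt, hB, Finset.mem_filter, true_and] at h
      exact fun S hS => supp_subset_of_isScreeningOutput hX.1 hb hlt hkd (fun i => (h i).1)
        (fun i => (h i).2) hS
  have hBi (i : Fin p) : P.real {ω | π ω ∈ B i} ≤ 2 * (1 / (p : ℝ) ^ 2) := by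
    -- A sample point supplies an embedding, so the cardinality divided by is nonzero.
    obtain ⟨ω⟩ := P.nonempty_of_neZero
    have hcard : (0 : ℝ) < Nat.card (Fin k ↪ Fin p) := by
      exact_mod_cast Nat.card_pos_iff.2 ⟨⟨π ω⟩, inferInstance⟩
    refine (hπ.measure_mem_le (B i)).trans ?_
    rw [div_le_iff₀ hcard, ← hexp]
    refine (hX.card_lt_abs_sum_hollowGram_le hc hp1 hpn hL5 hkμ z hz0 i).trans_eq ?_
    ring
  have hNi (i : Fin p) : P.real {ω | ε < |X.col i ⬝ᵥ η ω|} ≤ 2 * (1 / (p : ℝ) ^ 2) := by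
    rw [← hexp]
    exact measure_abs_dotProduct_gaussian_le P (X.col i) (hX.1.dotProduct_self i) σ η hη hηindep
      (by linarith)
  have hbad : P.real (⋃ i ∈ (Finset.univ : Finset (Fin p)),
      ({ω | π ω ∈ B i} ∪ {ω | ε < |X.col i ⬝ᵥ η ω|})) ≤ 4 / p := by
    calc _ ≤ ∑ i : Fin p, P.real ({ω | π ω ∈ B i} ∪ {ω | ε < |X.col i ⬝ᵥ η ω|}) :=
          measureReal_biUnion_finset_le _ _
      _ ≤ ∑ _i : Fin p, 4 * (1 / (p : ℝ) ^ 2) := by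
          refine Finset.sum_le_sum fun i _ => (measureReal_union_le _ _).trans ?_
          linarith [hBi i, hNi i]
      _ = 4 / p := by
          rw [Finset.sum_const, Finset.card_univ, Fintype.card_fin, nsmul_eq_mul]
          field_simp
  have htot := (measureReal_mono (μ := P) hcover).trans (measureReal_union_le _ _)
  rw [probReal_univ] at htot
  have h46 : (4 : ℝ) / p < 6 / p := by gcongr; norm_num
  linarith
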